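/- **Undefinability of truth (arithmetic).** Let $L_A$ be the first-order language of arithmetic with $0$, successor $s$, $+$, $\cdot$ and equality, and let $L_A^*$ be $L_A$ together with one new unary predicate symbol $V$. Formulas are built from $\bot$, atomic formulas $t=u$ and $V(t)$, $\to$ and $\forall$; the other connectives are the usual classical abbreviations ($\sim\varphi$ is $\varphi\to\bot$, and so on), and bound variables are named canonically: a quantifier in the scope of exactly $n$ other quantifiers binds $x_n$. Write $T\vdash S$ when the sentence $S$ is derivable from the set of sentences $T$ in classical first-order logic with equality. Gödel numbering: expressions are strings over the finite alphabet $(\;)\;\bot\;\to\;\forall\;=\;0\;s\;+\;\cdot\;V\;x\;'$, where the variable $x_i$ is written as $x$ followed by $i$ strokes. Fix any assignment of pairwise distinct positive integers $c(a)$ to the symbols $a$. The Gödel number of a string $a_1a_2\dots a_k$ is $2^{k}\cdot 3^{c(a_1)}\cdot 5^{c(a_2)}\cdots p_{k}^{\,c(a_k)}$, where $p_j$ is the $j$-th odd prime. For a sentence $S$ of $L_A^*$, $\#S$ denotes the numeral $s(\dots s(0)\dots)$ of the Gödel number of $S$. Let $\mathit{Arit}^*$ be any set of $L_A^*$-sentences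 which proves the axioms of Robinson arithmetic $Q$: $\forall x\, s(x)\neq 0$; $\forall x\forall y\,(s(x)=s(y)\to x=y)$; $\forall x\,(x\ne 0\to\exists y\, x=s(y))$; $\forall x\, x+0=x$; $\forall x\forall y\, x+s(y)=s(x+y)$; $\forall x\, x\cdot 0=0$; $\forall x\forall y\, x\cdot s(y)=x\cdot y+x$. If $$\mathit{Arit}^*\vdash V(\#S)\leftrightarrow S\qquad\text{for every sentence } S \text{ of } L_A^*,$$ then $\mathit{Arit}^*$ is inconsistent: there is a sentence $S$ of $L_A^*$ with $\mathit{Arit}^*\vdash S$ and $\mathit{Arit}^*\vdash{\sim}S$. -/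

import Mathlib

namespace TruthArith

open FirstOrder FirstOrder.Language

/-! ## The language of arithmetic with a truth predicate -/

/-- Function symbols of the language of arithmetic: `0`, successor, `+`, `·`. -/
inductive ArithFunc : ℕ → Type
  | zero : ArithFunc 0
  | succ : ArithFunc 1
  | add : ArithFunc 2
  | mul : ArithFunc 2

/-- The only relation symbol besides equality: the unary truth predicate `V`. -/
inductive TruthRel : ℕ → Type
  | V : TruthRel 1

/-- The language of arithmetic extended by the truth predicate. -/
abbrev LStar : FirstOrder.Language.{0, 0} := ⟨ArithFunc, TruthRel⟩

/-- Terms whose variables are among `x₀, …, x₍ₙ₋₁₎`. -/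
abbrev Tm (n : ℕ) : Type := LStar.Term (Empty ⊕ Fin n)

/-- Formulas whose free variables are among `x₀, …, x₍ₙ₋₁₎`. In `Fm n` the quantifier of `∀' φ`
binds the variable `xₙ` of `φ : Fm (n + 1)`. `Fm 0` is the type `LStar.Sentence`. -/
abbrev Fm (n : ℕ) : Type := LStar.BoundedFormula Empty n

/-- The variable `xᵢ` as a term. -/
abbrev vr {n : ℕ} (i : Fin n) : Tm n := Term.var (Sum.inr i)

def zeroT {n : ℕ} : Tm n := Term.func ArithFunc.zero ![]

def succT {n : ℕ} (t : Tm n) : Tm n := Term.func ArithFunc.succ ![t]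

def addT {n : ℕ} (t u : Tm n) : Tm n := Term.func ArithFunc.add ![t, u]

def mulT {n : ℕ} (t u : Tm n) : Tm n := Term.func ArithFunc.mul ![t, u]

/-- Equality of terms, as a formula. -/
def eqF {n : ℕ} (t u : Tm n) : Fm n := BoundedFormula.equal t u

/-- The atomic formula `V(t)`. -/
def truthF {n : ℕ} (t : Tm n) : Fm n := BoundedFormula.rel TruthRel.V ![t]

/-- The numeral of `k`: the term `s(s(…s(0)…))` with `k` occurrences of `s`. -/
def numeral {n : ℕ} : ℕ → Tm n
  | 0 => zeroT
  | k + 1 => succT (numeral k)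

/-! ## Substitution -/

/-- Simultaneous substitution of terms for the variables of a term. -/
def subTm {m n : ℕ} (σ : Fin m → Tm n) (t : Tm m) : Tm n :=
  t.subst (Sum.elim (fun e => e.elim) σ)

/-- A substitution, carried under one quantifier: the bound variable `xₘ` becomes the bound
variable `xₙ`, and the variables of the substituted terms are untouched. -/
def liftSub {m n : ℕ} (σ : Fin m → Tm n) : Fin (m + 1) → Tm (n + 1) :=
  Fin.snoc (α := fun _ => Tm (n + 1))
    (fun i => subTm (fun j => vr j.castSucc) (σ i)) (vr (Fin.last n))

/-- Simultaneous capture-avoiding substitution of terms for the free variables of a formula. -/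
def subFm : {m n : ℕ} → (Fin m → Tm n) → Fm m → Fm n
  | _, _, _, .falsum => .falsum
  | _, _, σ, .equal t u => .equal (subTm σ t) (subTm σ u)
  | _, _, σ, .rel R ts => .rel R (fun i => subTm σ (ts i))
  | _, _, σ, .imp φ ψ => .imp (subFm σ φ) (subFm σ ψ)
  | _, _, σ, .all φ => .all (subFm (liftSub σ) φ)

/-- A formula in `x₀, …, x₍ₙ₋₁₎` regarded as a formula in `x₀, …, xₙ`. -/
def weaken {n : ℕ} (φ : Fm n) : Fm (n + 1) := subFm (fun i => vr i.castSucc) φ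

/-- `inst φ t` is the formula `φ[t / xₙ]`. -/
def inst {n : ℕ} (φ : Fm (n + 1)) (t : Tm n) : Fm n :=
  subFm (Fin.snoc (α := fun _ => Tm n) (fun i => vr i) t) φ

/-! ## Classical first-order logic with equality -/

/-- Natural deduction for classical first-order logic with equality: `Derives Γ φ` says that `φ`
has a derivation from the open assumptions `Γ`, all in the free variables `x₀, …, x₍ₙ₋₁₎`.
In `all_intro` the eigenvariable is `xₙ`, which does not occur free in `Γ`. The other connectives
are Mathlib's: `∼φ` is `φ ⟹ ⊥`, `φ ⊓ ψ` is `∼(φ ⟹ ∼ψ)`, `∃' φ` is `∼(∀' ∼φ)`. -/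
inductive Derives : {n : ℕ} → Set (Fm n) → Fm n → Prop
  | hyp {n : ℕ} {Γ : Set (Fm n)} {φ : Fm n} : φ ∈ Γ → Derives Γ φ
  | imp_intro {n : ℕ} {Γ : Set (Fm n)} {φ ψ : Fm n} :
      Derives (insert φ Γ) ψ → Derives Γ (φ.imp ψ)
  | imp_elim {n : ℕ} {Γ : Set (Fm n)} {φ ψ : Fm n} :
      Derives Γ (φ.imp ψ) → Derives Γ φ → Derives Γ ψ
  | by_contra {n : ℕ} {Γ : Set (Fm n)} {φ : Fm n} :
      Derives (insert φ.not Γ) ⊥ → Derives Γ φ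
  | all_intro {n : ℕ} {Γ : Set (Fm n)} {φ : Fm (n + 1)} :
      Derives (weaken '' Γ) φ → Derives Γ φ.all
  | all_elim {n : ℕ} {Γ : Set (Fm n)} {φ : Fm (n + 1)} (t : Tm n) :
      Derives Γ φ.all → Derives Γ (inst φ t)
  | eq_refl {n : ℕ} {Γ : Set (Fm n)} (t : Tm n) : Derives Γ (eqF t t)
  | eq_subst {n : ℕ} {Γ : Set (Fm n)} (φ : Fm (n + 1)) {t u : Tm n} :
      Derives Γ (eqF t u) → Derives Γ (inst φ t) → Derives Γ (inst φ u)

/-- `T ⊢ S`: the sentence `S` is a theorem of the theory with axioms `T`. -/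
def Proves (T : LStar.Theory) (S : LStar.Sentence) : Prop := Derives (n := 0) T S

/-- A theory is inconsistent if it proves some sentence together with its negation. -/
def Inconsistent (T : LStar.Theory) : Prop :=
  ∃ S : LStar.Sentence, Proves T S ∧ Proves T S.not

/-! ## Robinson arithmetic -/

/-- The seven axioms of Robinson arithmetic `Q`. -/
inductive RobinsonQ : LStar.Sentence → Prop
  /-- `∀ x, s(x) ≠ 0` -/
  | succ_ne_zero : RobinsonQ (BoundedFormula.all
      (eqF (n := 1) (succT (vr 0)) zeroT).not)
  /-- `∀ x y, s(x) = s(y) → x = y` -/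
  | succ_inj : RobinsonQ (BoundedFormula.all (BoundedFormula.all
      ((eqF (n := 2) (succT (vr 0)) (succT (vr 1))).imp (eqF (vr 0) (vr 1)))))
  /-- `∀ x, x ≠ 0 → ∃ y, x = s(y)` -/
  | eq_succ : RobinsonQ (BoundedFormula.all
      ((eqF (n := 1) (vr 0) zeroT).not.imp
        (BoundedFormula.ex (eqF (n := 2) (vr 0) (succT (vr 1))))))
  /-- `∀ x, x + 0 = x` -/
  | add_zero : RobinsonQ (BoundedFormula.all
      (eqF (n := 1) (addT (vr 0) zeroT) (vr 0)))
  /-- `∀ x y, x + s(y) = s(x + y)` -/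
  | add_succ : RobinsonQ (BoundedFormula.all (BoundedFormula.all
      (eqF (n := 2) (addT (vr 0) (succT (vr 1))) (succT (addT (vr 0) (vr 1))))))
  /-- `∀ x, x · 0 = 0` -/
  | mul_zero : RobinsonQ (BoundedFormula.all
      (eqF (n := 1) (mulT (vr 0) zeroT) zeroT))
  /-- `∀ x y, x · s(y) = x · y + x` -/
  | mul_succ : RobinsonQ (BoundedFormula.all (BoundedFormula.all
      (eqF (n := 2) (mulT (vr 0) (succT (vr 1))) (addT (mulT (vr 0) (vr 1)) (vr 0)))))

/-- `T` is at least as strong as `Q`: it proves every axiom of `Q`. -/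
def ExtendsQ (T : LStar.Theory) : Prop :=
  ∀ S : LStar.Sentence, RobinsonQ S → Proves T S

/-! ## Gödel numbering -/

/-- The primitive symbols out of which expressions are written. The variable `xᵢ` is written as
the letter `x` followed by `i` strokes. -/
inductive Sym : Type
  | lpar | rpar | falsum | imp | all | eq | zero | succ | add | mul | V | x | stroke

/-- The variable `xᵢ` as a string of symbols. -/
def varStr (i : ℕ) : List Sym := Sym.x :: List.replicate i Sym.stroke

/-- A term as a string of symbols: `0`, `s(t)`, `(t+u)`, `(t·u)`. -/
def termStr {n : ℕ} : Tm n → List Sym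
  | .var (Sum.inr i) => varStr i
  | .func ArithFunc.zero _ => [Sym.zero]
  | .func ArithFunc.succ ts => [Sym.succ, Sym.lpar] ++ termStr (ts 0) ++ [Sym.rpar]
  | .func ArithFunc.add ts =>
      [Sym.lpar] ++ termStr (ts 0) ++ [Sym.add] ++ termStr (ts 1) ++ [Sym.rpar]
  | .func ArithFunc.mul ts =>
      [Sym.lpar] ++ termStr (ts 0) ++ [Sym.mul] ++ termStr (ts 1) ++ [Sym.rpar]

/-- A formula as a string of symbols: `⊥`, `(t=u)`, `V(t)`, `(φ→ψ)`, `∀xₙφ`. -/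
def fmStr : {n : ℕ} → Fm n → List Sym
  | _, .falsum => [Sym.falsum]
  | _, .equal t u => [Sym.lpar] ++ termStr t ++ [Sym.eq] ++ termStr u ++ [Sym.rpar]
  | _, .rel TruthRel.V ts => [Sym.V, Sym.lpar] ++ termStr (ts 0) ++ [Sym.rpar]
  | _, .imp φ ψ => [Sym.lpar] ++ fmStr φ ++ [Sym.imp] ++ fmStr ψ ++ [Sym.rpar]
  | n, .all φ => [Sym.all] ++ varStr n ++ fmStr φ

/-- Given integers `c a` assigned to the primitive symbols `a`, the number of the string
`a₁ a₂ … aₖ` is `2 ^ k * 3 ^ c a₁ * 5 ^ c a₂ * ⋯`: the exponent of the prime `2` records the length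
of the string, the exponents of the following primes the successive symbols. -/
noncomputable def strNumber (c : Sym → ℕ) (l : List Sym) : ℕ :=
  2 ^ l.length * ∏ i : Fin l.length, Nat.nth Nat.Prime (i + 1) ^ c (l.get i)

/-- The Gödel number of a sentence. -/
noncomputable def godelNumber (c : Sym → ℕ) (S : LStar.Sentence) : ℕ :=
  strNumber c (fmStr (n := 0) S)

/-- `#S`: the numeral of the Gödel number of `S`. -/
noncomputable def name (c : Sym → ℕ) (S : LStar.Sentence) : Tm 0 := numeral (godelNumber c S)

/-- The instance `V(#S) ↔ S` of the T-schema. -/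
noncomputable def tInstance (c : Sym → ℕ) (S : LStar.Sentence) : LStar.Sentence :=
  BoundedFormula.iff (truthF (name c S)) S

end TruthArith

namespace TruthArith

open FirstOrder FirstOrder.Language Filter

/-! ## The algebra of substitutions -/

/-! This is Tarski's liar argument, carried out inside a model. If the theory is consistent,
completeness gives a structure `M` satisfying all its theorems: a model of `Q` in which `V` holds at
the Gödel number of a sentence exactly when the sentence is true. A liar sentence contradicts this.

Working in one model replaces formal derivations in `Q` by reasoning about a structure. A function
only has to be represented in `M`: at a standard argument, the formula must single out the value
among all elements, nonstandard ones included. `representable_of_primrec` achieves this with Gödel's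
beta function and least codes.

Self-reference needs no arithmetized substitution. The failure of `φ` at `e` is expressed by `∀ x₀
(φ → x₀ ≠ e)`, whose string contains that of `φ` verbatim, so its Gödel number is `f e` for a
primitive recursive `f` and a code `e` of the string of `φ` (`exists_primrec_godelNumber_failsAt`).
For `φ(x)` saying that `V` holds at `f(x)`, the sentence numbered `f e` says that `V` fails at `f
e`.

Completeness (`exists_model_of_not_derives_falsum`) is a Henkin construction in which the variable
added at each stage serves as the witness; the model consists of terms modulo equality derivable at
all late stages. -/

theorem subTm_var {m n : ℕ} (σ : Fin m → Tm n) (i : Fin m) : subTm σ (vr i) = σ i := rfl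

theorem subTm_subTm {k m n : ℕ} (τ : Fin m → Tm n) (σ : Fin k → Tm m) (t : Tm k) :
    subTm τ (subTm σ t) = subTm (fun i => subTm τ (σ i)) t := by
  induction t with
  | var x => rcases x with e | i
             · exact e.elim
             · rfl
  | func f ts ih => exact congrArg (Term.func f) (funext ih)

theorem subTm_vr {n : ℕ} (t : Tm n) : subTm (fun i => vr i) t = t := by
  induction t with
  | var x => rcases x with e | i
             · exact e.elim
             · rfl
  | func f ts ih => exact congrArg (Term.func f) (funext ih)

theorem subTm_liftSub {k m n : ℕ} (τ : Fin m → Tm n) (σ : Fin k → Tm m) (i : Fin (k + 1)) :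
    subTm (liftSub τ) (liftSub σ i) = liftSub (fun j => subTm τ (σ j)) i := by
  refine Fin.lastCases ?_ (fun i => ?_) i
  · simp [liftSub, subTm_var]
  · simp [liftSub, subTm_subTm, subTm_var]

theorem liftSub_vr {n : ℕ} : liftSub (fun i : Fin n => vr i) = fun i => vr i := by
  funext i
  refine Fin.lastCases ?_ (fun i => ?_) i
  · simp [liftSub]
  · simp [liftSub, subTm_var]

theorem subFm_subFm {k m n : ℕ} (τ : Fin m → Tm n) (σ : Fin k → Tm m) (φ : Fm k) :
    subFm τ (subFm σ φ) = subFm (fun i => subTm τ (σ i)) φ := by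
  induction φ generalizing m n with
  | falsum => rfl
  | equal t u => simp [subFm, subTm_subTm]
  | rel R ts => simp [subFm, subTm_subTm]
  | imp φ ψ ih₁ ih₂ => simp [subFm, ih₁, ih₂]
  | all φ ih => simp [subFm, ih, subTm_liftSub]

theorem subFm_vr {n : ℕ} (φ : Fm n) : subFm (fun i => vr i) φ = φ := by
  induction φ with
  | falsum => rfl
  | equal t u => simp [subFm, subTm_vr]
  | rel R ts => simp [subFm, subTm_vr]
  | imp φ ψ ih₁ ih₂ => simp [subFm, ih₁, ih₂]
  | all φ ih => simp [subFm, ih, liftSub_vr]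

theorem weaken_subFm {m n : ℕ} (σ : Fin m → Tm n) (φ : Fm m) :
    weaken (subFm σ φ) = subFm (fun i => subTm (fun j => vr j.castSucc) (σ i)) φ :=
  subFm_subFm _ _ _

theorem subFm_liftSub_weaken {m n : ℕ} (σ : Fin m → Tm n) (φ : Fm m) :
    subFm (liftSub σ) (weaken φ) = weaken (subFm σ φ) := by
  simp [weaken, subFm_subFm, subTm_var, liftSub]

theorem inst_subFm_liftSub {m n : ℕ} (σ : Fin m → Tm n) (φ : Fm (m + 1)) (t : Tm n) :
    inst (subFm (liftSub σ) φ) t = subFm (Fin.snoc (α := fun _ => Tm n) σ t) φ := by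
  rw [inst, subFm_subFm]
  congr 1
  funext i
  refine Fin.lastCases ?_ (fun i => ?_) i
  · simp [liftSub, subTm_var]
  · simp [liftSub, subTm_subTm, subTm_var, subTm_vr]

theorem subFm_inst {m n : ℕ} (σ : Fin m → Tm n) (φ : Fm (m + 1)) (t : Tm m) :
    subFm σ (inst φ t) = inst (subFm (liftSub σ) φ) (subTm σ t) := by
  rw [inst_subFm_liftSub, inst, subFm_subFm]
  congr 1
  funext i
  refine Fin.lastCases ?_ (fun i => ?_) i
  · simp
  · simp [subTm_var]

/-! ## Admissible rules -/

/-- Induction on the derivation, lifting the substitution at `all_intro` so that the eigenvariable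
stays fresh. Monotonicity and weakening are the cases of the identity and of the inclusion of
variables. -/
theorem Derives.subst {m n : ℕ} {Γ : Set (Fm m)} {φ : Fm m} (h : Derives Γ φ)
    (σ : Fin m → Tm n) {Δ : Set (Fm n)} (hΔ : ∀ ψ ∈ Γ, subFm σ ψ ∈ Δ) :
    Derives Δ (subFm σ φ) := by
  induction h generalizing n with
  | hyp h => exact .hyp (hΔ _ h)
  | imp_intro _ ih =>
    exact .imp_intro (ih σ (by
      rintro ψ (rfl | h)
      · exact Set.mem_insert _ _
      · exact Set.mem_insert_of_mem _ (hΔ _ h)))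
  | imp_elim _ _ ih₁ ih₂ => exact .imp_elim (ih₁ σ hΔ) (ih₂ σ hΔ)
  | by_contra _ ih =>
    exact .by_contra (ih σ (by
      rintro ψ (rfl | h)
      · exact Set.mem_insert _ _
      · exact Set.mem_insert_of_mem _ (hΔ _ h)))
  | all_intro _ ih =>
    refine .all_intro (ih (liftSub σ) ?_)
    rintro _ ⟨ψ, h, rfl⟩
    exact ⟨_, hΔ _ h, (subFm_liftSub_weaken σ ψ).symm⟩
  | all_elim t _ ih => rw [subFm_inst]; exact .all_elim _ (ih σ hΔ)
  | eq_refl t => exact .eq_refl _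
  | eq_subst φ _ _ ih₁ ih₂ =>
    rw [subFm_inst]
    exact .eq_subst _ (ih₁ σ hΔ) (by simpa only [subFm_inst] using ih₂ σ hΔ)

theorem Derives.mono {n : ℕ} {Γ Δ : Set (Fm n)} {φ : Fm n} (h : Derives Γ φ) (hΔ : Γ ⊆ Δ) :
    Derives Δ φ := by
  simpa only [subFm_vr] using
    h.subst (fun i => vr i) (Δ := Δ) (fun ψ hψ => by rw [subFm_vr]; exact hΔ hψ)

theorem Derives.weaken {n : ℕ} {Γ : Set (Fm n)} {φ : Fm n} (h : Derives Γ φ) :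
    Derives (weaken '' Γ) (weaken φ) :=
  h.subst _ fun _ hψ => ⟨_, hψ, rfl⟩

theorem Derives.ex_falso {n : ℕ} {Γ : Set (Fm n)} (φ : Fm n) (h : Derives Γ ⊥) : Derives Γ φ :=
  .by_contra (h.mono (Set.subset_insert _ _))

theorem Derives.cut {n : ℕ} {Γ : Set (Fm n)} {φ ψ : Fm n} (h : Derives Γ φ)
    (h' : Derives (insert φ Γ) ψ) : Derives Γ ψ :=
  .imp_elim (.imp_intro h') h

theorem Derives.eq_symm {n : ℕ} {Γ : Set (Fm n)} {t u : Tm n} (h : Derives Γ (eqF t u)) :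
    Derives Γ (eqF u t) := by
  -- Leibniz's rule is used for the formula `xₙ = t`: at `t` it is reflexivity, at `u` it is the
  -- goal.
  have key : ∀ w, inst (eqF (vr (Fin.last n)) (subTm (fun j => vr j.castSucc) t)) w = eqF w t := by
    intro w
    simp [inst, eqF, subFm, subTm_subTm, subTm_var, subTm_vr]
  have := Derives.eq_subst (eqF (vr (Fin.last n)) (subTm (fun j => vr j.castSucc) t)) h
    (by rw [key]; exact .eq_refl t)
  rwa [key] at this

/-- Putting a fresh variable in the `i`-th slot gives the one-hole form required by `eq_subst`. -/
theorem Derives.eq_subst_update {m n : ℕ} {Γ : Set (Fm n)} (φ : Fm m) (σ : Fin m → Tm n)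
    (i : Fin m) {t u : Tm n} (h : Derives Γ (eqF t u))
    (hφ : Derives Γ (subFm (Function.update σ i t) φ)) :
    Derives Γ (subFm (Function.update σ i u) φ) := by
  let χ : Fm (n + 1) := subFm
    (Function.update (fun j => subTm (fun j => vr j.castSucc) (σ j)) i (vr (Fin.last n))) φ
  have key : ∀ w, inst χ w = subFm (Function.update σ i w) φ := by
    intro w
    rw [inst, subFm_subFm]
    congr 1
    funext j
    rcases eq_or_ne j i with rfl | hj
    · simp [subTm_var]
    · simp [hj, subTm_subTm, subTm_var, subTm_vr]
  have := Derives.eq_subst χ h (by rwa [key])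
  rwa [key] at this

/-- One coordinate is exchanged at a time, by induction on the set of those already exchanged. -/
theorem Derives.eq_congr {m n : ℕ} {Γ : Set (Fm n)} (φ : Fm m) {σ τ : Fin m → Tm n}
    (h : ∀ i, Derives Γ (eqF (σ i) (τ i))) (hφ : Derives Γ (subFm σ φ)) :
    Derives Γ (subFm τ φ) := by
  classical
  have key : ∀ s : Finset (Fin m), Derives Γ (subFm (fun i => if i ∈ s then τ i else σ i) φ) := by
    intro s
    induction s using Finset.induction with
    | empty => simpa using hφ
    | insert a s ha ih =>
      have e₁ : (fun i => if i ∈ s then τ i else σ i) =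
          Function.update (fun i => if i ∈ s then τ i else σ i) a (σ a) := by
        funext j
        rcases eq_or_ne j a with rfl | hj
        · simp [ha]
        · simp [hj]
      have e₂ : (fun i => if i ∈ insert a s then τ i else σ i) =
          Function.update (fun i => if i ∈ s then τ i else σ i) a (τ a) := by
        funext j
        rcases eq_or_ne j a with rfl | hj
        · simp
        · simp [hj]
      rw [e₂]
      rw [e₁] at ih
      exact Derives.eq_subst_update φ _ a (h a) ih
  simpa using key Finset.univ

theorem Derives.func_congr {n k : ℕ} {Γ : Set (Fm n)} (f : LStar.Functions k)
    {ts us : Fin k → Tm n} (h : ∀ i, Derives Γ (eqF (ts i) (us i))) :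
    Derives Γ (eqF (Term.func f ts) (Term.func f us)) := by
  -- In `f(x) = f(y)`, with `2k` distinct variables, only the right half changes from `ts` to `us`,
  -- starting from reflexivity.
  have key (σ : Fin (k + k) → Tm n) :
      subFm σ (eqF (Term.func f fun i => vr (Fin.castAdd k i))
        (Term.func f fun i => vr (Fin.natAdd k i))) =
      eqF (Term.func f fun i => σ (Fin.castAdd k i)) (Term.func f fun i => σ (Fin.natAdd k i)) :=
    rfl
  have := Derives.eq_congr (Γ := Γ) (eqF (Term.func f fun i => vr (Fin.castAdd k i))
    (Term.func f fun i => vr (Fin.natAdd k i))) (σ := Fin.append ts ts) (τ := Fin.append ts us)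
    (fun i => Fin.addCases (fun i => by simpa only [Fin.append_left] using .eq_refl _)
      (fun i => by simpa only [Fin.append_right] using h i) i)
  simp only [key, Fin.append_left, Fin.append_right] at this
  exact this (.eq_refl _)

/-! ## The Henkin construction -/

/-- One step of the Henkin construction: `θ` is accepted if this is consistent, and if `θ` is a
rejected universal formula then the new variable becomes a counterexample to it. -/
def henkinStep {n : ℕ} (Γ : Set (Fm n)) (θ : Fm n) : Set (Fm (n + 1)) :=
  {ψ | ψ ∈ weaken '' Γ ∨ (¬ Derives (insert θ Γ) ⊥ ∧ ψ = weaken θ) ∨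
    (Derives (insert θ Γ) ⊥ ∧ ∃ χ : Fm (n + 1), θ = χ.all ∧ ψ = χ.not)}

/-- The unused new variable is generalized and then instantiated by the closed term `0`. -/
theorem not_derives_weaken_image {n : ℕ} {Γ : Set (Fm n)} (h : ¬ Derives Γ ⊥) :
    ¬ Derives (weaken '' Γ) ⊥ :=
  fun h' => h (.all_elim (φ := ⊥) zeroT (.all_intro h'))

theorem henkinStep_consistent {n : ℕ} {Γ : Set (Fm n)} (θ : Fm n) (h : ¬ Derives Γ ⊥) :
    ¬ Derives (henkinStep Γ θ) ⊥ := by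
  intro h'
  by_cases hθ : Derives (insert θ Γ) ⊥
  · by_cases hχ : ∃ χ : Fm (n + 1), θ = χ.all
    · obtain ⟨χ, rfl⟩ := hχ
      -- If `∼χ` at the new variable were inconsistent, `Γ` would derive `∀' χ`, which was rejected
      -- as inconsistent with `Γ`.
      refine h (.cut (.all_intro (.by_contra (h'.mono ?_))) hθ)
      rintro ψ (hψ | ⟨hn, _⟩ | ⟨_, χ', e, rfl⟩)
      · exact Set.mem_insert_of_mem _ hψ
      · exact absurd hθ hn
      · cases e
        exact Set.mem_insert _ _
    · refine not_derives_weaken_image h (h'.mono ?_)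
      rintro ψ (hψ | ⟨hn, _⟩ | ⟨_, χ', e, rfl⟩)
      · exact hψ
      · exact absurd hθ hn
      · exact absurd ⟨_, e⟩ hχ
  · refine not_derives_weaken_image hθ (h'.mono ?_)
    rintro ψ (⟨χ, hχ, rfl⟩ | ⟨_, rfl⟩ | ⟨hn, _⟩)
    · exact ⟨χ, Set.mem_insert_of_mem _ hχ, rfl⟩
    · exact ⟨θ, Set.mem_insert _ _, rfl⟩
    · exact absurd hn hθ

/-- A term in infinitely many variables, cut down to the first `N` of them. -/
def truncate (N : ℕ) (t : LStar.Term ℕ) : Tm N :=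
  t.subst fun i => if h : i < N then vr ⟨i, h⟩ else zeroT

/-- Only finitely many variables occur in `t`; once `N` exceeds them, the default `0` in `truncate`
plays no role. -/
theorem eventually_truncate_succ (t : LStar.Term ℕ) :
    ∀ᶠ N in atTop, subTm (fun j => vr j.castSucc) (truncate N t) = truncate (N + 1) t := by
  induction t with
  | var i =>
    filter_upwards [eventually_gt_atTop i] with N hN
    simp [truncate, hN, Nat.lt_succ_of_lt hN, subTm]
  | func f ts ih =>
    filter_upwards [eventually_all.2 ih] with N hN
    exact congrArg (Term.func f) (funext hN)

/-- A formula together with terms in infinitely many variables to be substituted into it. -/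
abbrev Instance : Type := Σ n : ℕ, Fm n × (Fin n → LStar.Term ℕ)

/-- The instance as a formula in the first `N` variables. -/
def Instance.at (p : Instance) (N : ℕ) : Fm N := subFm (fun i => truncate N (p.2.2 i)) p.2.1

theorem Instance.weaken_at {n N : ℕ} (φ : Fm n) {σ : Fin n → LStar.Term ℕ}
    (h : ∀ i, subTm (fun j => vr j.castSucc) (truncate N (σ i)) = truncate (N + 1) (σ i)) :
    weaken (Instance.at ⟨n, φ, σ⟩ N) = Instance.at ⟨n, φ, σ⟩ (N + 1) := by
  rw [Instance.at, weaken_subFm]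
  exact congrArg (subFm · φ) (funext h)

theorem Instance.eventually_weaken (p : Instance) :
    ∀ᶠ N in atTop, weaken (p.at N) = p.at (N + 1) :=
  (eventually_all.2 fun i => eventually_truncate_succ (p.2.2 i)).mono fun _ hN =>
    Instance.weaken_at p.2.1 hN

instance : Countable LStar.Symbols := by
  have h₁ : Countable (Σ n, ArithFunc n) := by
    refine Function.Injective.countable (f := fun p : Σ n, ArithFunc n => match p with
      | ⟨_, .zero⟩ => 0 | ⟨_, .succ⟩ => 1 | ⟨_, .add⟩ => 2 | ⟨_, .mul⟩ => (3 : ℕ)) ?_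
    rintro ⟨_, _ | _ | _ | _⟩ ⟨_, _ | _ | _ | _⟩ h <;> simp_all
  have h₂ : Countable (Σ n, TruthRel n) := by
    refine Function.Injective.countable (f := fun _ : Σ n, TruthRel n => (0 : ℕ)) ?_
    rintro ⟨_, _ | _⟩ ⟨_, _ | _⟩ _
    rfl
  exact inferInstanceAs (Countable ((Σ n, ArithFunc n) ⊕ (Σ n, TruthRel n)))

instance : Countable Instance := by
  have : Countable (Σ l, LStar.Functions l) :=
    Function.Injective.countable (β := LStar.Symbols) Sum.inl_injective
  have h (n : ℕ) : Countable (Fm n) :=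
    Function.Injective.countable (β := Σ n, Fm n) (sigma_mk_injective (i := n))
  infer_instance

/-- Instances must recur in the Henkin construction, since truncation is faithful only at stages
beyond their variables. -/
theorem exists_enumeration_frequently (α : Type) [Countable α] [Nonempty α] :
    ∃ e : ℕ → α, ∀ a, ∃ᶠ n in atTop, e n = a := by
  obtain ⟨f, hf⟩ := exists_surjective_nat α
  refine ⟨fun n => f n.unpair.1, fun a => frequently_atTop.2 fun N => ?_⟩
  obtain ⟨k, rfl⟩ := hf a
  exact ⟨Nat.pair k N, Nat.right_le_pair _ _, by simp⟩

/-! ### Truth at late stages -/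

section Henkin

variable (T : LStar.Theory) (e : ℕ → Instance)

/-- The stages of the Henkin construction. -/
def stage : (N : ℕ) → Set (Fm N)
  | 0 => T
  | N + 1 => henkinStep (stage N) ((e N).at N)

/-- `φ`, with the terms `σ` substituted, is derivable from all late stages. -/
def Holds {n : ℕ} (φ : Fm n) (σ : Fin n → LStar.Term ℕ) : Prop :=
  ∀ᶠ N in atTop, Derives (stage T e N) (Instance.at ⟨n, φ, σ⟩ N)

variable {T e}

theorem stage_consistent (h : ¬ Derives (n := 0) T ⊥) (N : ℕ) : ¬ Derives (stage T e N) ⊥ := by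
  induction N with
  | zero => exact h
  | succ N ih => exact henkinStep_consistent _ ih

theorem Derives.stage_succ {N : ℕ} {φ : Fm N} (h : Derives (stage T e N) φ) :
    Derives (stage T e (N + 1)) (TruthArith.weaken φ) :=
  h.weaken.mono fun _ => Or.inl

theorem holds_of_derives {N : ℕ} {p : Instance}
    (hp : ∀ K, N ≤ K → TruthArith.weaken (p.at K) = p.at (K + 1))
    (h : Derives (stage T e N) (p.at N)) : Holds T e p.2.1 p.2.2 := by
  refine eventually_atTop.2 ⟨N, fun K hK => ?_⟩
  induction K, hK using Nat.le_induction with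
  | base => exact h
  | succ K hK ih => exact hp K hK ▸ ih.stage_succ

/-- Eventually truncation commutes with weakening, and from there a single derivation propagates to
all later stages. -/
theorem holds_of_frequently {n : ℕ} {φ : Fm n} {σ : Fin n → LStar.Term ℕ}
    (h : ∃ᶠ N in atTop, Derives (stage T e N) (Instance.at ⟨n, φ, σ⟩ N)) : Holds T e φ σ := by
  obtain ⟨N₀, h₀⟩ := eventually_atTop.1 (Instance.eventually_weaken ⟨n, φ, σ⟩)
  obtain ⟨N, hN, h⟩ := frequently_atTop.1 h N₀
  exact holds_of_derives (p := ⟨n, φ, σ⟩) (fun K hK => h₀ K (hN.trans hK)) h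

theorem not_holds_falsum (h : ¬ Derives (n := 0) T ⊥) {n : ℕ} (σ : Fin n → LStar.Term ℕ) :
    ¬ Holds T e ⊥ σ := fun h' =>
  let ⟨N, hN⟩ := h'.exists
  stage_consistent h N hN

theorem Holds.mp {n : ℕ} {φ ψ : Fm n} {σ : Fin n → LStar.Term ℕ} (h : Holds T e (φ.imp ψ) σ)
    (h' : Holds T e φ σ) : Holds T e ψ σ := by
  filter_upwards [h, h'] with N h₁ h₂
  exact .imp_elim h₁ h₂

/-- Every instance is decided at infinitely many stages. -/
theorem frequently_decided (he : ∀ p, ∃ᶠ N in atTop, e N = p) {n : ℕ} {φ : Fm n}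
    {σ : Fin n → LStar.Term ℕ} (h : ¬ Holds T e φ σ) :
    ∃ᶠ N in atTop, e N = ⟨n, φ, σ⟩ ∧
      Derives (insert (Instance.at ⟨n, φ, σ⟩ N) (stage T e N)) ⊥ := by
  by_contra hc
  -- Otherwise every late presentation of the instance is accepted, which places it in the next
  -- stage.
  refine h (holds_of_frequently ?_)
  rw [not_frequently] at hc
  refine (tendsto_add_atTop_nat 1).frequently ?_
  refine ((he ⟨n, φ, σ⟩).and_eventually
    (hc.and (Instance.eventually_weaken ⟨n, φ, σ⟩))).mono ?_
  rintro N ⟨h₁, h₂, h₃⟩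
  rw [← h₃]
  refine .hyp (Or.inr (Or.inl ?_))
  rw [h₁]
  exact ⟨fun h => h₂ ⟨h₁, h⟩, rfl⟩

theorem holds_not_of_not_holds (he : ∀ p, ∃ᶠ N in atTop, e N = p) {n : ℕ} {φ : Fm n}
    {σ : Fin n → LStar.Term ℕ} (h : ¬ Holds T e φ σ) : Holds T e φ.not σ :=
  holds_of_frequently ((frequently_decided he h).mono fun _ hN => .imp_intro hN.2)

theorem holds_imp (he : ∀ p, ∃ᶠ N in atTop, e N = p) {n : ℕ}
    {φ ψ : Fm n} {σ : Fin n → LStar.Term ℕ} :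
    Holds T e (φ.imp ψ) σ ↔ (Holds T e φ σ → Holds T e ψ σ) := by
  refine ⟨Holds.mp, fun h => ?_⟩
  by_cases hφ : Holds T e φ σ
  · exact (h hφ).mono fun N hN => .imp_intro (hN.mono (Set.subset_insert _ _))
  · refine (holds_not_of_not_holds he hφ).mono fun N hN => .imp_intro (.ex_falso _ ?_)
    exact .imp_elim (hN.mono (Set.subset_insert _ _)) (.hyp (Set.mem_insert _ _))

theorem truncate_snoc {n : ℕ} (N : ℕ) (σ : Fin n → LStar.Term ℕ) (t : LStar.Term ℕ) :
    (fun i => truncate N (Fin.snoc (α := fun _ => LStar.Term ℕ) σ t i)) =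
      Fin.snoc (α := fun _ => Tm N) (fun i => truncate N (σ i)) (truncate N t) :=
  funext fun i => Fin.lastCases (by simp) (fun i => by simp) i

theorem holds_all (hT : ¬ Derives (n := 0) T ⊥) (he : ∀ p, ∃ᶠ N in atTop, e N = p) {n : ℕ}
    {φ : Fm (n + 1)} {σ : Fin n → LStar.Term ℕ} :
    Holds T e φ.all σ ↔ ∀ t, Holds T e φ (Fin.snoc (α := fun _ => LStar.Term ℕ) σ t) := by
  constructor
  · intro h t
    filter_upwards [h] with N hN
    have := Derives.all_elim (truncate N t) hN
    rw [inst_subFm_liftSub] at this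
    rwa [Instance.at, truncate_snoc]
  · intro h
    by_contra hc
    obtain ⟨N₀, h₀⟩ := eventually_atTop.1
      (eventually_all.2 fun i => eventually_truncate_succ (σ i))
    -- The universal formula is rejected at stage `N`, so the variable `x_N` added there is a
    -- counterexample.
    obtain ⟨N, hN, h₁, h₂⟩ := frequently_atTop.1 (frequently_decided he hc) N₀
    have hlast (K : ℕ) (hK : N < K) : truncate K (Term.var N) = vr ⟨N, hK⟩ := by
      simp [truncate, Term.subst, hK]
    have hneg : Holds T e φ.not (Fin.snoc (α := fun _ => LStar.Term ℕ) σ (Term.var N)) := by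
      refine holds_of_derives (N := N + 1) (p := ⟨n + 1, φ.not, Fin.snoc σ (Term.var N)⟩)
        (fun K hK => Instance.weaken_at _ fun i => ?_) (.hyp (Or.inr (Or.inr ?_)))
      · refine Fin.lastCases ?_ (fun i => ?_) i
        · rw [Fin.snoc_last, hlast K hK, hlast (K + 1) (by omega)]
          rfl
        · rw [Fin.snoc_castSucc]
          exact h₀ _ (by omega) i
      · rw [h₁]
        refine ⟨h₂, _, rfl, ?_⟩
        rw [Instance.at, truncate_snoc, ← funext (h₀ N hN), hlast _ N.lt_succ_self]
        rfl
    exact not_holds_falsum hT _ (hneg.mp (h _))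

/-! ## The term model -/

theorem subTm_truncate {n : ℕ} (N : ℕ) (σ : Fin n → LStar.Term ℕ) (t : Tm n) :
    subTm (fun i => truncate N (σ i)) t =
      truncate N (t.subst (Sum.elim (fun e => e.elim) σ)) := by
  induction t with
  | var x => rcases x with e | i
             · exact e.elim
             · rfl
  | func f ts ih => exact congrArg (Term.func f) (funext ih)

variable (T e) in
/-- Terms that are provably equal at all late stages. -/
def termSetoid : Setoid (LStar.Term ℕ) where
  r t u := ∀ᶠ N in atTop, Derives (stage T e N) (eqF (truncate N t) (truncate N u))
  iseqv := {
    refl := fun t => .of_forall fun N => .eq_refl _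
    symm := fun h => h.mono fun N hN => hN.eq_symm
    trans := fun {t u w} h h' => by
      filter_upwards [h, h'] with N h₁ h₂
      have := Derives.eq_congr (Γ := stage T e N) (eqF (vr 0) (vr 1))
        (σ := ![truncate N t, truncate N u]) (τ := ![truncate N t, truncate N w])
        (Fin.forall_fin_two.2 ⟨.eq_refl _, h₂⟩)
      exact this h₁ }

theorem Holds.congr {n : ℕ} {φ : Fm n} {σ τ : Fin n → LStar.Term ℕ}
    (h : ∀ i, termSetoid T e (σ i) (τ i)) (hφ : Holds T e φ σ) : Holds T e φ τ := by
  filter_upwards [eventually_all.2 h, hφ] with N h₁ h₂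
  exact h₂.eq_congr φ h₁

theorem holds_equal {n : ℕ} {t u : Tm n} {σ : Fin n → LStar.Term ℕ} :
    Holds T e (.equal t u) σ ↔ termSetoid T e (t.subst (Sum.elim (fun e => e.elim) σ))
      (u.subst (Sum.elim (fun e => e.elim) σ)) := by
  refine eventually_congr (.of_forall fun N => ?_)
  rw [← subTm_truncate, ← subTm_truncate]
  rfl

theorem holds_rel {n k : ℕ} {R : LStar.Relations k} {ts : Fin k → Tm n}
    {σ : Fin n → LStar.Term ℕ} :
    Holds T e (.rel R ts) σ ↔ Holds T e (.rel R fun i => vr i)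
      fun i => (ts i).subst (Sum.elim (fun e => e.elim) σ) := by
  refine eventually_congr (.of_forall fun N => ?_)
  simp only [Instance.at, subFm, subTm_truncate, subTm_var]

variable (T e) in
instance termPrestructure : LStar.Prestructure (termSetoid T e) where
  toStructure :=
    { funMap := fun f ts => Term.func f ts
      RelMap := fun R ts => Holds T e (.rel R fun i => vr i) ts }
  fun_equiv {_ _} x y h := by
    change ∀ᶠ N in atTop, _
    filter_upwards [eventually_all.2 h] with N hN
    exact Derives.func_congr _ hN
  rel_equiv {_ _} x y h := propext ⟨fun h' => h'.congr h,
    fun h' => h'.congr fun i => (termSetoid T e).symm (h i)⟩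

variable (T e) in
/-- The term model of a Henkin construction. -/
def TermModel : Type := Quotient (termSetoid T e)

instance : LStar.Structure (TermModel T e) :=
  @quotientStructure _ _ _ (termPrestructure T e)

variable (T e) in
def TermModel.mk (t : LStar.Term ℕ) : TermModel T e := Quotient.mk _ t

instance : Nonempty (TermModel T e) := ⟨TermModel.mk T e (Term.var 0)⟩

theorem TermModel.realize_term {n : ℕ} (σ : Fin n → LStar.Term ℕ) (t : Tm n) :
    t.realize (Sum.elim default fun i => mk T e (σ i)) =
      mk T e (t.subst (Sum.elim (fun e => e.elim) σ)) := by
  induction t with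
  | var x => rcases x with e | i
             · exact e.elim
             · rfl
  | func f ts ih =>
    simp only [Term.realize, ih]
    exact @funMap_quotient_mk' _ _ (termSetoid T e) (termPrestructure T e) _ f _

theorem TermModel.snoc_mk {n : ℕ} (σ : Fin n → LStar.Term ℕ) (t : LStar.Term ℕ) :
    Fin.snoc (α := fun _ => TermModel T e) (fun i => mk T e (σ i)) (mk T e t) =
      fun i => mk T e (Fin.snoc (α := fun _ => LStar.Term ℕ) σ t i) :=
  funext fun i => Fin.lastCases (by simp) (fun i => by simp) i

/-- The truth lemma: implication works because undecided instances become refuted, quantification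
because of the Henkin counterexamples and because every element is the class of a term. -/
theorem TermModel.realize_iff_holds (hT : ¬ Derives (n := 0) T ⊥)
    (he : ∀ p, ∃ᶠ N in atTop, e N = p) {n : ℕ} (φ : Fm n) (σ : Fin n → LStar.Term ℕ) :
    φ.Realize default (fun i => mk T e (σ i)) ↔ Holds T e φ σ := by
  induction φ with
  | falsum => exact ⟨False.elim, not_holds_falsum hT σ⟩
  | equal t u =>
    rw [holds_equal]
    change Term.realize _ t = Term.realize _ u ↔ _
    rw [realize_term, realize_term]
    exact Quotient.eq
  | rel R ts =>
    rw [holds_rel]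
    change Structure.RelMap R (fun i => Term.realize _ (ts i)) ↔ _
    simp only [realize_term]
    exact @relMap_quotient_mk' _ _ (termSetoid T e) (termPrestructure T e) _ R _
  | imp φ ψ ih₁ ih₂ => rw [holds_imp he, ← ih₁, ← ih₂, BoundedFormula.realize_imp]
  | all φ ih =>
    rw [holds_all hT he, BoundedFormula.realize_all]
    simp only [← ih, ← snoc_mk]
    exact ⟨fun h t => h _, fun h x => Quotient.inductionOn x h⟩

end Henkin

/-- The completeness theorem, for the language `LStar`. -/
theorem exists_model_of_not_derives_falsum {T : LStar.Theory} (hT : ¬ Derives (n := 0) T ⊥) :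
    ∃ (M : Type) (_ : LStar.Structure M) (_ : Nonempty M),
      ∀ S : LStar.Sentence, Proves T S → S.Realize M := by
  obtain ⟨e, he⟩ := @exists_enumeration_frequently Instance _ ⟨⟨0, ⊥, Fin.elim0⟩⟩
  refine ⟨TermModel T e, inferInstance, inferInstance, fun S hS => ?_⟩
  have h := (TermModel.realize_iff_holds hT he (n := 0) S Fin.elim0).2
    (holds_of_derives (N := 0) (p := ⟨0, S, Fin.elim0⟩)
      (fun K _ => Instance.weaken_at _ fun i => i.elim0)
      (by rw [Instance.at, Subsingleton.elim (fun i : Fin 0 => _) (fun i => vr i), subFm_vr]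
          exact hS))
  rwa [Subsingleton.elim (fun i : Fin 0 => _) default] at h

/-! ## Models of Robinson arithmetic -/

section Model

variable {M : Type} [LStar.Structure M]

variable (M) in
def qZero : M := Structure.funMap (L := LStar) ArithFunc.zero ![]

def qSucc (x : M) : M := Structure.funMap (L := LStar) ArithFunc.succ ![x]

def qAdd (x y : M) : M := Structure.funMap (L := LStar) ArithFunc.add ![x, y]

def qMul (x y : M) : M := Structure.funMap (L := LStar) ArithFunc.mul ![x, y]

/-- The interpretation of the truth predicate. -/
def qTrue (x : M) : Prop := Structure.RelMap (L := LStar) TruthRel.V ![x]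

variable (M) in
/-- The axioms of Robinson arithmetic, as properties of a structure. -/
structure IsRobinson : Prop where
  succ_ne_zero (x : M) : qSucc x ≠ qZero M
  succ_inj (x y : M) : qSucc x = qSucc y → x = y
  eq_succ (x : M) : x ≠ qZero M → ∃ y, x = qSucc y
  add_zero (x : M) : qAdd x (qZero M) = x
  add_succ (x y : M) : qAdd x (qSucc y) = qSucc (qAdd x y)
  mul_zero (x : M) : qMul x (qZero M) = qZero M
  mul_succ (x y : M) : qMul x (qSucc y) = qAdd (qMul x y) x

/-! ### Realization of terms and formulas -/

theorem comp_vecCons {α β : Type} {n : ℕ} (f : α → β) (a : α) (v : Fin n → α) :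
    f ∘ (Matrix.vecCons a v) = Matrix.vecCons (f a) (f ∘ v) := by
  funext i
  refine Fin.cases rfl (fun i => rfl) i

theorem comp_vecEmpty {α β : Type} (f : α → β) (v : Fin 0 → α) : f ∘ v = ![] :=
  Subsingleton.elim _ _

theorem snoc_vecEmpty {α : Type} (v : Fin 0 → α) (a : α) :
    Fin.snoc (α := fun _ => α) v a = ![a] := by
  funext i
  rw [show i = Fin.last 0 from Fin.ext (by omega), Fin.snoc_last]
  rfl

variable {n : ℕ} (v : Fin n → M)

/-- The value of a term under an assignment. -/
def val (t : Tm n) : M := t.realize (Sum.elim default v)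

theorem val_vr (i : Fin n) : val v (vr i) = v i := rfl

theorem val_func {k : ℕ} (f : LStar.Functions k) (ts : Fin k → Tm n) :
    val v (Term.func f ts) = Structure.funMap f (val v ∘ ts) := rfl

theorem val_zeroT : val v zeroT = qZero M := by
  rw [zeroT, val_func, comp_vecEmpty, qZero]

theorem val_succT (t : Tm n) : val v (succT t) = qSucc (val v t) := by
  rw [succT, val_func, comp_vecCons, comp_vecEmpty, qSucc]

theorem val_addT (t u : Tm n) : val v (addT t u) = qAdd (val v t) (val v u) := by
  rw [addT, val_func, comp_vecCons, comp_vecCons, comp_vecEmpty, qAdd]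

theorem val_mulT (t u : Tm n) : val v (mulT t u) = qMul (val v t) (val v u) := by
  rw [mulT, val_func, comp_vecCons, comp_vecCons, comp_vecEmpty, qMul]

theorem val_subTm {m : ℕ} (σ : Fin m → Tm n) (t : Tm m) :
    val v (subTm σ t) = val (val v ∘ σ) t := by
  induction t with
  | var x => rcases x with e | i
             · exact e.elim
             · rfl
  | func f ts ih => exact congrArg (Structure.funMap f) (funext ih)

/-- Satisfaction of a formula under an assignment. -/
def Sat (φ : Fm n) : Prop := φ.Realize default v

theorem sat_eqF (t u : Tm n) : Sat v (eqF t u) ↔ val v t = val v u := Iff.rfl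

theorem sat_truthF (t : Tm n) : Sat v (truthF t) ↔ qTrue (val v t) := by
  rw [qTrue, ← comp_vecEmpty (val v) ![], ← comp_vecCons]
  rfl

theorem sat_imp (φ ψ : Fm n) : Sat v (φ.imp ψ) ↔ (Sat v φ → Sat v ψ) :=
  BoundedFormula.realize_imp

theorem sat_not (φ : Fm n) : Sat v φ.not ↔ ¬ Sat v φ := BoundedFormula.realize_not

theorem sat_inf (φ ψ : Fm n) : Sat v (φ ⊓ ψ) ↔ Sat v φ ∧ Sat v ψ := BoundedFormula.realize_inf

theorem sat_sup (φ ψ : Fm n) : Sat v (φ ⊔ ψ) ↔ Sat v φ ∨ Sat v ψ := BoundedFormula.realize_sup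

theorem sat_all (φ : Fm (n + 1)) :
    Sat v φ.all ↔ ∀ a, Sat (Fin.snoc (α := fun _ => M) v a) φ := BoundedFormula.realize_all

theorem sat_ex (φ : Fm (n + 1)) :
    Sat v φ.ex ↔ ∃ a, Sat (Fin.snoc (α := fun _ => M) v a) φ := BoundedFormula.realize_ex

theorem val_liftSub {m : ℕ} (σ : Fin m → Tm n) (a : M) :
    val (Fin.snoc (α := fun _ => M) v a) ∘ liftSub σ =
      Fin.snoc (α := fun _ => M) (val v ∘ σ) a := by
  funext i
  refine Fin.lastCases ?_ (fun i => ?_) i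
  · simp [liftSub, val_vr]
  · simp only [liftSub, Function.comp_apply, Fin.snoc_castSucc, val_subTm]
    congr 1
    funext j
    simp [val_vr]

theorem sat_subFm {m : ℕ} (σ : Fin m → Tm n) (φ : Fm m) :
    Sat v (subFm σ φ) ↔ Sat (val v ∘ σ) φ := by
  induction φ generalizing n with
  | falsum => rfl
  | equal t u =>
    change val v (subTm σ t) = val v (subTm σ u) ↔ val _ t = val _ u
    rw [val_subTm, val_subTm]
  | rel R ts =>
    change Structure.RelMap R (fun i => val v (subTm σ (ts i))) ↔
      Structure.RelMap R (fun i => val _ (ts i))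
    simp only [val_subTm]
  | imp φ ψ ih₁ ih₂ => rw [subFm, sat_imp, sat_imp, ih₁, ih₂]
  | all φ ih =>
    rw [subFm, sat_all, sat_all]
    exact forall_congr' fun a => by rw [ih, val_liftSub]

end Model

theorem isRobinson_of_realize {M : Type} [LStar.Structure M]
    (h : ∀ S : LStar.Sentence, RobinsonQ S → S.Realize M) : IsRobinson M := by
  have h' (S : Fm 0) (hS : RobinsonQ S) : Sat (default : Fin 0 → M) S := h S hS
  constructor
  · simpa [sat_all, sat_not, sat_eqF, val_succT, val_zeroT, val_vr, snoc_vecEmpty] using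
      h' _ .succ_ne_zero
  · simpa [sat_all, sat_imp, sat_eqF, val_succT, val_vr, snoc_vecEmpty] using
      h' _ .succ_inj
  · simpa [sat_all, sat_imp, sat_not, sat_ex, sat_eqF, val_succT, val_zeroT, val_vr,
      snoc_vecEmpty] using h' _ .eq_succ
  · simpa [sat_all, sat_eqF, val_addT, val_zeroT, val_vr, snoc_vecEmpty] using h' _ .add_zero
  · simpa [sat_all, sat_eqF, val_addT, val_succT, val_vr, snoc_vecEmpty] using
      h' _ .add_succ
  · simpa [sat_all, sat_eqF, val_mulT, val_zeroT, val_vr, snoc_vecEmpty] using h' _ .mul_zero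
  · simpa [sat_all, sat_eqF, val_mulT, val_addT, val_succT, val_vr, snoc_vecEmpty] using
      h' _ .mul_succ

/-! ### The standard numbers of a model -/

section Standard

variable {M : Type} [LStar.Structure M]

variable (M) in
/-- The value of the numeral of `k`. -/
def num : ℕ → M
  | 0 => qZero M
  | k + 1 => qSucc (num k)

theorem val_numeral {n : ℕ} (v : Fin n → M) (k : ℕ) : val v (numeral k) = num M k := by
  induction k with
  | zero => exact val_zeroT v
  | succ k ih => rw [numeral, val_succT, ih, num]

/-- `x < y`. -/
def qLt (x y : M) : Prop := ∃ z, qAdd z (qSucc x) = y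

namespace IsRobinson

variable (hM : IsRobinson M)
include hM

theorem num_injective : Function.Injective (num M) := by
  intro a
  induction a with
  | zero =>
    rintro (_ | b) h
    · rfl
    · exact absurd h.symm (hM.succ_ne_zero _)
  | succ a ih =>
    rintro (_ | b) h
    · exact absurd h (hM.succ_ne_zero _)
    · rw [ih (hM.succ_inj _ _ h)]

theorem num_inj {a b : ℕ} : num M a = num M b ↔ a = b := (num_injective hM).eq_iff

theorem num_add (a b : ℕ) : qAdd (num M a) (num M b) = num M (a + b) := by
  induction b with
  | zero => exact hM.add_zero _
  | succ b ih => rw [num, hM.add_succ, ih]; rfl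

theorem num_mul (a b : ℕ) : qMul (num M a) (num M b) = num M (a * b) := by
  induction b with
  | zero => exact hM.mul_zero _
  | succ b ih => rw [num, hM.mul_succ, ih, num_add hM]; rfl

/-- In `z + s(x) = s(n)` the recursion for `+` cancels a successor, leaving the same problem for the
predecessor of `x`. -/
theorem lt_num_iff {x : M} {n : ℕ} : qLt x (num M n) ↔ ∃ k < n, x = num M k := by
  constructor
  · rintro ⟨z, hz⟩
    induction n generalizing x with
    | zero =>
      rw [hM.add_succ] at hz
      exact absurd hz (hM.succ_ne_zero _)
    | succ n ih =>
      rw [hM.add_succ] at hz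
      by_cases hx : x = qZero M
      · exact ⟨0, n.succ_pos, hx⟩
      · obtain ⟨y, rfl⟩ := hM.eq_succ x hx
        obtain ⟨k, hk, rfl⟩ := ih (hM.succ_inj _ _ hz)
        exact ⟨k + 1, Nat.succ_lt_succ hk, rfl⟩
  · rintro ⟨k, hk, rfl⟩
    obtain ⟨j, rfl⟩ := Nat.exists_eq_add_of_lt hk
    refine ⟨num M j, ?_⟩
    change qAdd (num M j) (num M (k + 1)) = _
    rw [num_add hM]
    congr 1
    omega

theorem num_lt_num {a b : ℕ} : qLt (num M a) (num M b) ↔ a < b := by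
  rw [lt_num_iff hM]
  refine ⟨?_, fun h => ⟨a, h, rfl⟩⟩
  rintro ⟨k, hk, h⟩
  rwa [num_injective hM h]

/-- Order need not be linear in a model of `Q`, but comparison with a standard number reduces to
predecessors. This is what makes least codes standard. -/
theorem num_trichotomy (x : M) (n : ℕ) : (∃ k ≤ n, x = num M k) ∨ qLt (num M n) x := by
  induction n generalizing x with
  | zero =>
    by_cases hx : x = qZero M
    · exact Or.inl ⟨0, le_rfl, hx⟩
    · obtain ⟨y, rfl⟩ := hM.eq_succ x hx
      exact Or.inr ⟨y, by rw [num, hM.add_succ, hM.add_zero]⟩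
  | succ n ih =>
    by_cases hx : x = qZero M
    · exact Or.inl ⟨0, Nat.zero_le _, hx⟩
    · obtain ⟨y, rfl⟩ := hM.eq_succ x hx
      rcases ih y with ⟨k, hk, rfl⟩ | ⟨z, rfl⟩
      · exact Or.inl ⟨k + 1, Nat.succ_le_succ hk, rfl⟩
      · exact Or.inr ⟨z, by rw [num, hM.add_succ]⟩

end IsRobinson

end Standard

/-! ### Definable relations and representable functions -/

section Representable

variable {M : Type} [LStar.Structure M]

/-- A binary relation on `M` is definable without parameters. -/
def Definable₂ (R : M → M → Prop) : Prop := ∃ φ : Fm 2, ∀ x y, Sat ![x, y] φ ↔ R x y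

/-- A ternary relation on `M` is definable without parameters. -/
def Definable₃ (R : M → M → M → Prop) : Prop :=
  ∃ φ : Fm 3, ∀ x y z, Sat ![x, y, z] φ ↔ R x y z

variable (M) in
/-- `f` is represented by a formula: for a standard argument, the only value that the formula
allows, even among the nonstandard elements of `M`, is that of `f`. -/
def Representable (f : ℕ → ℕ) : Prop :=
  ∃ R : M → M → Prop, Definable₂ R ∧ ∀ n y, R (num M n) y ↔ y = num M (f n)

/-- The graph of `Nat.pair`. -/
def qPair (a b x : M) : Prop :=
  (qLt a b ∧ x = qAdd (qMul b b) a) ∨ (¬ qLt a b ∧ x = qAdd (qAdd (qMul a a) a) b)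

/-- The graph of the first component of `Nat.unpair`. -/
def qLeft (x y : M) : Prop := qLt y (qSucc x) ∧ ∃ b, qLt b (qSucc x) ∧ qPair y b x

/-- The graph of the second component of `Nat.unpair`. -/
def qRight (x y : M) : Prop := qLt y (qSucc x) ∧ ∃ a, qLt a (qSucc x) ∧ qPair a y x

/-- The graph of `Nat.beta`. -/
def qBeta (c i u : M) : Prop :=
  ∃ a b, qLeft c a ∧ qRight c b ∧ qLt u (qSucc (qMul (qSucc i) b)) ∧
    ∃ q, qLt q (qSucc a) ∧ a = qAdd (qMul (qSucc (qMul (qSucc i) b)) q) u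

/-- By way of `Nat.beta`, `c` codes the first `n + 1` values of the function defined from `R` and
`S` by primitive recursion with parameter `z`. -/
def qCodes (R S : M → M → Prop) (z n c : M) : Prop :=
  (∃ u, R z u ∧ qBeta c (qZero M) u) ∧
    ∀ i, qLt i n → ∃ u w, qBeta c i u ∧ qBeta c (qSucc i) w ∧
      ∃ p q, qPair i u p ∧ qPair z p q ∧ S q w

/-- The graph of the function defined from `R` and `S` by primitive recursion, read off from the
least code of its values. -/
def qPrec (R S : M → M → Prop) (x y : M) : Prop :=
  ∃ z n c, qLeft x z ∧ qRight x n ∧ qCodes R S z n c ∧ qBeta c n y ∧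
    ∀ d, qLt d c → ¬ qCodes R S z n d

/-! ### Defining formulas for the graphs -/

theorem definable_qLt : Definable₂ (qLt (M := M)) :=
  ⟨(eqF (addT (vr 2) (succT (vr 0))) (vr 1)).ex, fun x y => by
    simp [sat_ex, sat_eqF, val_addT, val_succT, val_vr, qLt, snoc_vecEmpty]⟩

theorem definable_qPair : Definable₃ (qPair (M := M)) := by
  obtain ⟨φ, hφ⟩ := definable_qLt (M := M)
  refine ⟨(subFm ![vr 0, vr 1] φ ⊓ eqF (vr 2) (addT (mulT (vr 1) (vr 1)) (vr 0))) ⊔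
    ((subFm ![vr 0, vr 1] φ).not ⊓
      eqF (vr 2) (addT (addT (mulT (vr 0) (vr 0)) (vr 0)) (vr 1))), fun x y z => ?_⟩
  simp [sat_sup, sat_inf, sat_not, sat_subFm, comp_vecCons, comp_vecEmpty, hφ, sat_eqF, val_addT,
    val_mulT, val_vr, qPair]

theorem definable_qLeft : Definable₂ (qLeft (M := M)) := by
  obtain ⟨φ, hφ⟩ := definable_qLt (M := M)
  obtain ⟨ψ, hψ⟩ := definable_qPair (M := M)
  refine ⟨subFm ![vr 1, succT (vr 0)] φ ⊓
    (subFm ![vr 2, succT (vr 0)] φ ⊓ subFm ![vr 1, vr 2, vr 0] ψ).ex, fun x y => ?_⟩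
  simp [sat_ex, sat_inf, sat_subFm, comp_vecCons, comp_vecEmpty, hφ, hψ, val_succT, val_vr, qLeft,
    snoc_vecEmpty]

theorem definable_qRight : Definable₂ (qRight (M := M)) := by
  obtain ⟨φ, hφ⟩ := definable_qLt (M := M)
  obtain ⟨ψ, hψ⟩ := definable_qPair (M := M)
  refine ⟨subFm ![vr 1, succT (vr 0)] φ ⊓
    (subFm ![vr 2, succT (vr 0)] φ ⊓ subFm ![vr 2, vr 1, vr 0] ψ).ex, fun x y => ?_⟩
  simp [sat_ex, sat_inf, sat_subFm, comp_vecCons, comp_vecEmpty, hφ, hψ, val_succT, val_vr, qRight,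
    snoc_vecEmpty]

theorem definable_qBeta : Definable₃ (qBeta (M := M)) := by
  obtain ⟨φ, hφ⟩ := definable_qLt (M := M)
  obtain ⟨l, hl⟩ := definable_qLeft (M := M)
  obtain ⟨r, hr⟩ := definable_qRight (M := M)
  refine ⟨(subFm ![vr 0, vr 3] l ⊓ (subFm ![vr 0, vr 4] r ⊓
    (subFm ![vr 2, succT (mulT (succT (vr 1)) (vr 4))] φ ⊓
      (subFm ![vr 5, succT (vr 3)] φ ⊓
        eqF (vr 3) (addT (mulT (succT (mulT (succT (vr 1)) (vr 4))) (vr 5)) (vr 2))).ex))).ex.ex,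
    fun x y z => ?_⟩
  simp [sat_ex, sat_inf, sat_subFm, comp_vecCons, comp_vecEmpty, hφ, hl, hr, sat_eqF, val_addT,
    val_mulT, val_succT, val_vr, qBeta, snoc_vecEmpty]

theorem definable_qCodes {R S : M → M → Prop} (hR : Definable₂ R) (hS : Definable₂ S) :
    Definable₃ (qCodes R S) := by
  obtain ⟨φ, hφ⟩ := definable_qLt (M := M)
  obtain ⟨π, hπ⟩ := definable_qPair (M := M)
  obtain ⟨β, hβ⟩ := definable_qBeta (M := M)
  obtain ⟨ρ, hρ⟩ := hR
  obtain ⟨σ, hσ⟩ := hS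
  -- The variable `x₃` is `u` in the first conjunct and `i` in the second, where `x₄`, `x₅`, `x₆`,
  -- `x₇` are `u`, `w`, `p`, `q`.
  refine ⟨(subFm ![vr 0, vr 3] ρ ⊓ subFm ![vr 2, zeroT, vr 3] β).ex ⊓
    ((subFm ![vr 3, vr 1] φ).imp (subFm ![vr 2, vr 3, vr 4] β ⊓
      (subFm ![vr 2, succT (vr 3), vr 5] β ⊓ (subFm ![vr 3, vr 4, vr 6] π ⊓
        (subFm ![vr 0, vr 6, vr 7] π ⊓ subFm ![vr 7, vr 5] σ)).ex.ex)).ex.ex).all,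
    fun x y z => ?_⟩
  simp [sat_ex, sat_all, sat_imp, sat_inf, sat_subFm, comp_vecCons, comp_vecEmpty, hφ, hπ, hβ, hρ,
    hσ, val_succT, val_zeroT, val_vr, qCodes, snoc_vecEmpty]

theorem definable_qPrec {R S : M → M → Prop} (hR : Definable₂ R) (hS : Definable₂ S) :
    Definable₂ (qPrec R S) := by
  obtain ⟨φ, hφ⟩ := definable_qLt (M := M)
  obtain ⟨l, hl⟩ := definable_qLeft (M := M)
  obtain ⟨r, hr⟩ := definable_qRight (M := M)
  obtain ⟨β, hβ⟩ := definable_qBeta (M := M)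
  obtain ⟨γ, hγ⟩ := definable_qCodes hR hS
  refine ⟨(subFm ![vr 0, vr 2] l ⊓ (subFm ![vr 0, vr 3] r ⊓ (subFm ![vr 2, vr 3, vr 4] γ ⊓
    (subFm ![vr 4, vr 3, vr 1] β ⊓ ((subFm ![vr 5, vr 4] φ).imp
      (subFm ![vr 2, vr 3, vr 5] γ).not).all)))).ex.ex.ex, fun x y => ?_⟩
  simp [sat_ex, sat_all, sat_imp, sat_inf, sat_not, sat_subFm, comp_vecCons, comp_vecEmpty, hφ, hl,
    hr, hβ, hγ, val_vr, qPrec, snoc_vecEmpty]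

/-! ### Values at standard arguments -/

namespace IsRobinson

variable (hM : IsRobinson M)
include hM

theorem qPair_num {a b : ℕ} {x : M} :
    qPair (num M a) (num M b) x ↔ x = num M (Nat.pair a b) := by
  simp only [qPair, hM.num_lt_num, hM.num_mul, hM.num_add, Nat.pair]
  by_cases h : a < b <;> simp [h]

theorem qLt_succ_num {x : M} {n : ℕ} : qLt x (qSucc (num M n)) ↔ ∃ k ≤ n, x = num M k := by
  change qLt x (num M (n + 1)) ↔ _
  simp only [hM.lt_num_iff, Nat.lt_succ_iff]

/-- The bounds built into `qLeft` force both components to be standard. -/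
theorem qLeft_num {n : ℕ} {y : M} : qLeft (num M n) y ↔ y = num M n.unpair.1 := by
  simp only [qLeft, hM.qLt_succ_num]
  constructor
  · rintro ⟨⟨a, _, rfl⟩, _, ⟨b, _, rfl⟩, h⟩
    rw [hM.num_inj.1 (hM.qPair_num.1 h), Nat.unpair_pair]
  · rintro rfl
    exact ⟨⟨_, n.unpair_left_le, rfl⟩, _, ⟨_, n.unpair_right_le, rfl⟩,
      hM.qPair_num.2 (by rw [Nat.pair_unpair])⟩

theorem qRight_num {n : ℕ} {y : M} : qRight (num M n) y ↔ y = num M n.unpair.2 := by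
  simp only [qRight, hM.qLt_succ_num]
  constructor
  · rintro ⟨⟨b, _, rfl⟩, _, ⟨a, _, rfl⟩, h⟩
    rw [hM.num_inj.1 (hM.qPair_num.1 h), Nat.unpair_pair]
  · rintro rfl
    exact ⟨⟨_, n.unpair_right_le, rfl⟩, _, ⟨_, n.unpair_left_le, rfl⟩,
      hM.qPair_num.2 (by rw [Nat.pair_unpair])⟩

/-- The bounds on remainder and quotient make both standard, so uniqueness of division in `ℕ`
applies. -/
theorem qBeta_num {c i : ℕ} {u : M} :
    qBeta (num M c) (num M i) u ↔ u = num M (Nat.beta c i) := by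
  have key (a b : ℕ) : qSucc (qMul (qSucc (num M a)) (num M b)) = num M ((a + 1) * b + 1) := by
    change qSucc (qMul (num M (a + 1)) (num M b)) = _
    rw [hM.num_mul]
    rfl
  simp only [qBeta, hM.qLeft_num, hM.qRight_num]
  constructor
  · rintro ⟨_, _, rfl, rfl, hu, q, hq, h⟩
    rw [key] at hu h
    obtain ⟨u, hu', rfl⟩ := hM.lt_num_iff.1 hu
    obtain ⟨q, _, rfl⟩ := hM.qLt_succ_num.1 hq
    rw [hM.num_mul, hM.num_add, hM.num_inj] at h
    rw [Nat.beta, h, Nat.mul_add_mod, Nat.mod_eq_of_lt hu']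
  · rintro rfl
    refine ⟨_, _, rfl, rfl, ?_, num M (c.unpair.1 / ((i + 1) * c.unpair.2 + 1)), ?_, ?_⟩
    · rw [key, hM.num_lt_num]
      exact Nat.mod_lt _ (Nat.succ_pos _)
    · exact hM.qLt_succ_num.2 ⟨_, Nat.div_le_self _ _, rfl⟩
    · rw [key, hM.num_mul, hM.num_add, hM.num_inj, Nat.beta, Nat.div_add_mod]

theorem qCodes_num {R S : M → M → Prop} {f g : ℕ → ℕ}
    (hR : ∀ n y, R (num M n) y ↔ y = num M (f n)) (hS : ∀ n y, S (num M n) y ↔ y = num M (g n))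
    {z n c : ℕ} : qCodes R S (num M z) (num M n) (num M c) ↔
      Nat.beta c 0 = f z ∧
        ∀ i < n, Nat.beta c (i + 1) = g (Nat.pair z (Nat.pair i (Nat.beta c i))) := by
  have hzero (u : M) : qBeta (num M c) (qZero M) u ↔ u = num M (Nat.beta c 0) :=
    hM.qBeta_num (i := 0)
  have hsucc (i : ℕ) (u : M) :
      qBeta (num M c) (qSucc (num M i)) u ↔ u = num M (Nat.beta c (i + 1)) :=
    hM.qBeta_num (i := i + 1)
  refine and_congr ?_ ⟨fun h i hi => ?_, fun h i hi => ?_⟩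
  · simp [hR, hzero, hM.num_inj, eq_comm]
  · obtain ⟨_, _, hu, hw, _, _, hp, hq, hs⟩ := h (num M i) (hM.num_lt_num.2 hi)
    rw [hM.qBeta_num] at hu
    rw [hsucc] at hw
    subst hu hw
    rw [hM.qPair_num] at hp
    subst hp
    rw [hM.qPair_num] at hq
    subst hq
    rwa [hS, hM.num_inj] at hs
  · obtain ⟨i, hi', rfl⟩ := hM.lt_num_iff.1 hi
    exact ⟨_, _, hM.qBeta_num.2 rfl, (hsucc _ _).2 rfl, _, _, hM.qPair_num.2 rfl,
      hM.qPair_num.2 rfl, (hS _ _).2 (by rw [h i hi'])⟩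

end IsRobinson

/-! ### Closure properties of representable functions -/

theorem exists_beta_eq (h : ℕ → ℕ) (n : ℕ) : ∃ c, ∀ i ≤ n, Nat.beta c i = h i := by
  refine ⟨Nat.unbeta ((List.range (n + 1)).map h), fun i hi => ?_⟩
  have := Nat.beta_unbeta_coe ((List.range (n + 1)).map h)
    ⟨i, by simpa using Nat.lt_succ_of_le hi⟩
  simpa using this

/-- A nonstandard element could satisfy `qCodes` and yet give a wrong value at `n`; minimality of
the code excludes this. -/
theorem Representable.prec (hM : IsRobinson M) {f g : ℕ → ℕ} (hf : Representable M f)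
    (hg : Representable M g) : Representable M (Nat.unpaired fun z n =>
      n.rec (f z) fun y IH => g (Nat.pair z (Nat.pair y IH))) := by
  obtain ⟨R, hR, hRf⟩ := hf
  obtain ⟨S, hS, hSg⟩ := hg
  refine ⟨_, definable_qPrec hR hS, fun x y => ?_⟩
  set z := x.unpair.1 with hz
  set n := x.unpair.2 with hn
  let h : ℕ → ℕ := fun n => n.rec (f z) fun y IH => g (Nat.pair z (Nat.pair y IH))
  change _ ↔ y = num M (h n)
  have hval (c : ℕ) (hc : qCodes R S (num M z) (num M n) (num M c)) : Nat.beta c n = h n := by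
    rw [hM.qCodes_num hRf hSg] at hc
    have (i : ℕ) (hi : i ≤ n) : Nat.beta c i = h i := by
      induction i with
      | zero => exact hc.1
      | succ i ih => rw [hc.2 i hi, ih (Nat.le_of_succ_le hi)]
    exact this n le_rfl
  have hex : ∃ c, qCodes R S (num M z) (num M n) (num M c) := by
    obtain ⟨c, hc⟩ := exists_beta_eq h n
    refine ⟨c, (hM.qCodes_num hRf hSg).2 ⟨hc 0 (Nat.zero_le n), fun i hi => ?_⟩⟩
    rw [hc i hi.le, hc (i + 1) hi]
  classical
  constructor
  · rintro ⟨_, _, c, hz', hn', hc, hy, hmin⟩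
    rw [hM.qLeft_num] at hz'
    rw [hM.qRight_num] at hn'
    subst hz' hn'
    -- Either `c` is standard, or the least standard code lies below it, against minimality.
    rcases hM.num_trichotomy c (Nat.find hex) with ⟨k, _, rfl⟩ | hlt
    · rw [hM.qBeta_num] at hy
      rw [hy, hval k hc]
    · exact absurd (Nat.find_spec hex) (hmin _ hlt)
  · rintro rfl
    refine ⟨_, _, num M (Nat.find hex), hM.qLeft_num.2 rfl, hM.qRight_num.2 rfl,
      Nat.find_spec hex, hM.qBeta_num.2 (by rw [hval _ (Nat.find_spec hex)]), ?_⟩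
    intro d hd hc
    obtain ⟨k, hk, rfl⟩ := hM.lt_num_iff.1 hd
    exact Nat.find_min hex hk hc

theorem Representable.comp {f g : ℕ → ℕ} (hf : Representable M f)
    (hg : Representable M g) : Representable M fun n => f (g n) := by
  obtain ⟨R, ⟨ρ, hρ⟩, hRf⟩ := hf
  obtain ⟨S, ⟨σ, hσ⟩, hSg⟩ := hg
  refine ⟨fun x y => ∃ u, S x u ∧ R u y,
    ⟨(subFm ![vr 0, vr 2] σ ⊓ subFm ![vr 2, vr 1] ρ).ex, fun x y => ?_⟩, fun n y => ?_⟩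
  · simp [sat_ex, sat_inf, sat_subFm, comp_vecCons, comp_vecEmpty, hρ, hσ, val_vr, snoc_vecEmpty]
  · simp [hSg, hRf]

theorem Representable.pair (hM : IsRobinson M) {f g : ℕ → ℕ} (hf : Representable M f)
    (hg : Representable M g) : Representable M fun n => Nat.pair (f n) (g n) := by
  obtain ⟨R, ⟨ρ, hρ⟩, hRf⟩ := hf
  obtain ⟨S, ⟨σ, hσ⟩, hSg⟩ := hg
  obtain ⟨π, hπ⟩ := definable_qPair (M := M)
  refine ⟨fun x y => ∃ u w, R x u ∧ S x w ∧ qPair u w y,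
    ⟨(subFm ![vr 0, vr 2] ρ ⊓ (subFm ![vr 0, vr 3] σ ⊓ subFm ![vr 2, vr 3, vr 1] π)).ex.ex,
      fun x y => ?_⟩, fun n y => ?_⟩
  · simp [sat_ex, sat_inf, sat_subFm, comp_vecCons, comp_vecEmpty, hρ, hσ, hπ, val_vr,
      snoc_vecEmpty]
  · simp [hRf, hSg, hM.qPair_num]

/-- Primitive recursive functions are representable. -/
theorem representable_of_primrec (hM : IsRobinson M) {f : ℕ → ℕ} (hf : Nat.Primrec f) :
    Representable M f := by
  induction hf with
  | zero =>
    exact ⟨fun _ y => y = qZero M, ⟨eqF (vr 1) zeroT, fun x y => by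
      simp [sat_eqF, val_vr, val_zeroT]⟩, fun _ _ => Iff.rfl⟩
  | succ =>
    exact ⟨fun x y => y = qSucc x, ⟨eqF (vr 1) (succT (vr 0)), fun x y => by
      simp [sat_eqF, val_vr, val_succT]⟩, fun _ _ => Iff.rfl⟩
  | left => exact ⟨_, definable_qLeft, fun _ _ => hM.qLeft_num⟩
  | right => exact ⟨_, definable_qRight, fun _ _ => hM.qRight_num⟩
  | pair _ _ ihf ihg => exact ihf.pair hM ihg
  | comp _ _ ihf ihg => exact ihf.comp ihg
  | prec _ _ ihf ihg => exact ihf.prec hM ihg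

end Representable

/-! ## Gödel numbers are primitive recursive in the string -/

theorem primrecPred_prime : PrimrecPred Nat.Prime := by
  have h : PrimrecRel fun d n : ℕ => n % d ≠ 0 ∨ d = 1 :=
    PrimrecPred.or
      (PrimrecPred.not (Primrec.eq.comp (Primrec.nat_mod.comp .snd .fst) (.const 0)))
      (Primrec.eq.comp .fst (.const 1))
  refine (PrimrecPred.and (Primrec.nat_le.comp (.const 2) .id)
    (h.forall_lt.comp .id .id)).of_eq fun n => ?_
  simp only [id, Nat.prime_def_lt, Nat.dvd_iff_mod_eq_zero, or_iff_not_imp_left, not_not]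

theorem primrec_nat_pow : Primrec₂ fun a n : ℕ => a ^ n := by
  refine (Primrec.nat_rec' (f := fun p : ℕ × ℕ => p.2) (g := fun _ => 1)
    (h := fun p q => q.2 * p.1) .snd (.const 1)
    (Primrec.nat_mul.comp (Primrec.snd.comp .snd) (Primrec.fst.comp .fst)).to₂).of_eq ?_
  rintro ⟨a, n⟩
  induction n with
  | zero => rfl
  | succ n ih => exact (congrArg (· * a) ih).trans (pow_succ a n).symm

/-- Bertrand's postulate; any primitive recursive bound would do, to make the search for the next
prime bounded. -/
theorem nth_prime_le (n : ℕ) : Nat.nth Nat.Prime n ≤ 2 ^ (n + 1) := by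
  induction n with
  | zero => rw [Nat.nth_prime_zero_eq_two]; norm_num
  | succ n ih =>
    obtain ⟨p, hp, hlt, hle⟩ := Nat.exists_prime_lt_and_le_two_mul (Nat.nth Nat.Prime n)
      (Nat.prime_nth_prime n).ne_zero
    have h := Nat.count_monotone Nat.Prime hlt
    rw [Nat.count_nth_succ_of_infinite Nat.infinite_setOfPred_prime] at h
    calc Nat.nth Nat.Prime (n + 1) ≤ Nat.nth Nat.Prime (Nat.count Nat.Prime p) :=
          Nat.nth_monotone Nat.infinite_setOfPred_prime h
      _ = p := Nat.nth_count hp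
      _ ≤ 2 ^ (n + 1 + 1) := by rw [pow_succ']; omega

theorem primrec_nth_prime : Primrec (Nat.nth Nat.Prime) := by
  have hcount : Primrec (Nat.count Nat.Prime) :=
    (Primrec.list_length.comp ((Primrec.listFilter primrecPred_prime).comp
      Primrec.list_range)).of_eq fun n => by
        rw [Nat.count, List.countP_eq_length_filter]
  refine Primrec.of_graph ⟨fun n => 2 ^ (n + 1),
    primrec_nat_pow.comp (.const 2) .succ, nth_prime_le⟩ ?_
  refine (PrimrecPred.and (primrecPred_prime.comp .snd)
    (Primrec.eq.comp (hcount.comp .snd) .fst)).of_eq ?_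
  rintro ⟨n, p⟩
  change Nat.Prime p ∧ Nat.count Nat.Prime p = n ↔ Nat.nth Nat.Prime n = p
  constructor
  · rintro ⟨hp, rfl⟩
    exact Nat.nth_count hp
  · rintro rfl
    exact ⟨Nat.prime_nth_prime n, Nat.count_nth_of_infinite Nat.infinite_setOfPred_prime n⟩

/-- The number of a string, given as the list of the integers assigned to its symbols. -/
noncomputable def codeNumber (l : List ℕ) : ℕ :=
  2 ^ l.length * ∏ i ∈ Finset.range l.length, Nat.nth Nat.Prime (i + 1) ^ l.getD i 0

/-- The default `0` of `getD` is never reached, all indices being below the length. -/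
theorem codeNumber_map (c : Sym → ℕ) (l : List Sym) : codeNumber (l.map c) = strNumber c l := by
  rw [codeNumber, strNumber, List.length_map, Finset.prod_range]
  simp

theorem primrec_codeNumber : Primrec codeNumber := by
  have hprod : Primrec fun l : List ℕ =>
      ∏ i ∈ Finset.range l.length, Nat.nth Nat.Prime (i + 1) ^ l.getD i 0 := by
    refine (Primrec.nat_rec' (f := List.length) (g := fun _ => 1)
      (h := fun (l : List ℕ) q => q.2 * Nat.nth Nat.Prime (q.1 + 1) ^ l.getD q.1 0)
      .list_length (.const 1) ?_).of_eq fun l => ?_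
    · refine (Primrec.nat_mul.comp (Primrec.snd.comp .snd) (primrec_nat_pow.comp
        (primrec_nth_prime.comp (Primrec.succ.comp (Primrec.fst.comp .snd)))
        ((Primrec.list_getD 0).comp .fst (Primrec.fst.comp .snd)))).to₂
    · generalize List.length l = n
      induction n with
      | zero => rfl
      | succ n ih => rw [Finset.prod_range_succ, ← ih]
  exact Primrec.nat_mul.comp (primrec_nat_pow.comp (.const 2) .list_length) hprod

/-- The string of a numeral. -/
def numeralStr : ℕ → List Sym
  | 0 => [.zero]
  | k + 1 => [.succ, .lpar] ++ numeralStr k ++ [.rpar]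

theorem termStr_numeral {n : ℕ} (k : ℕ) : termStr (numeral k : Tm n) = numeralStr k := by
  induction k with
  | zero => simp [numeral, zeroT, termStr, numeralStr]
  | succ k ih => simp [numeral, succT, termStr, numeralStr, ih]

theorem primrec_numeralStr (c : Sym → ℕ) : Primrec fun k => (numeralStr k).map c := by
  refine (Primrec.nat_rec₁ (f := fun _ l => [c .succ, c .lpar] ++ l ++ [c .rpar]) [c .zero]
    (Primrec.list_append.comp (Primrec.list_append.comp (.const _) .snd) (.const _)).to₂).of_eq ?_
  intro k
  induction k with
  | zero => rfl
  | succ k ih =>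
    refine (congrArg (fun l => [c .succ, c .lpar] ++ l ++ [c .rpar]) ih).trans ?_
    simp [numeralStr]

/-! ## The liar sentence -/

/-- The sentence `∀ x₀ (φ → x₀ ≠ e)`, which says that `φ` fails at the number `e`. -/
def failsAt (φ : Fm 1) (e : ℕ) : Fm 0 := (φ.imp (eqF (vr 0) (numeral e)).not).all

/-- Bound variables are named by depth, and `φ : Fm 1` already counts the outer quantifier, so its
string is copied without renaming. -/
theorem fmStr_failsAt (φ : Fm 1) (e : ℕ) : fmStr (failsAt φ e) =
    [.all, .x, .lpar] ++ fmStr φ ++ [.imp, .lpar, .lpar, .x, .eq] ++ numeralStr e ++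
      [.rpar, .imp, .falsum, .rpar, .rpar] := by
  simp [failsAt, fmStr, eqF, BoundedFormula.not, termStr, termStr_numeral, varStr,
    Bot.bot]

/-- The Gödel number of `failsAt φ e`, computed from the number `e` of the string of `φ`. -/
theorem exists_primrec_godelNumber_failsAt (c : Sym → ℕ) : ∃ f : ℕ → ℕ, Nat.Primrec f ∧
    ∀ φ : Fm 1, ∃ e, godelNumber c (failsAt φ e) = f e := by
  -- Here `e` is a list code of the integers assigned to the string of `φ`, not its Gödel number:
  -- `f` only decodes, splices and applies the prime-power numbering.
  refine ⟨fun e => codeNumber ([c .all, c .x, c .lpar] ++ Denumerable.ofNat (List ℕ) e ++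
    [c .imp, c .lpar, c .lpar, c .x, c .eq] ++ (numeralStr e).map c ++
      [c .rpar, c .imp, c .falsum, c .rpar, c .rpar]), Primrec.nat_iff.1 ?_, fun φ =>
        ⟨Encodable.encode ((fmStr φ).map c), ?_⟩⟩
  · have h := Primrec.list_append.comp (Primrec.list_append.comp (Primrec.list_append.comp
      (Primrec.list_append.comp (.const [c .all, c .x, c .lpar]) (Primrec.ofNat (List ℕ)))
      (.const [c .imp, c .lpar, c .lpar, c .x, c .eq])) (primrec_numeralStr c))
      (.const [c .rpar, c .imp, c .falsum, c .rpar, c .rpar])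
    exact primrec_codeNumber.comp h
  · rw [godelNumber, ← codeNumber_map, fmStr_failsAt]
    simp

theorem sat_failsAt {M : Type} [LStar.Structure M] (φ : Fm 1) (e : ℕ) :
    Sat (default : Fin 0 → M) (failsAt φ e) ↔ ¬ Sat ![num M e] φ := by
  simp only [failsAt, sat_all, sat_imp, sat_not, sat_eqF, snoc_vecEmpty, val_vr, val_numeral]
  exact ⟨fun h hφ => h _ hφ rfl, fun h a hφ ha => h (by subst ha; exact hφ)⟩

end TruthArith

/-! ### The liar in a model -/

theorem mainTheorem1 (c : TruthArith.Sym → ℕ) (hc : Function.Injective c)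
    (hpos : ∀ a : TruthArith.Sym, 0 < c a)
    (Arit : TruthArith.LStar.Theory) (hQ : TruthArith.ExtendsQ Arit)
    (hT : ∀ S : TruthArith.LStar.Sentence,
      TruthArith.Proves Arit (TruthArith.tInstance c S)) :
    TruthArith.Inconsistent Arit := by
  open TruthArith FirstOrder FirstOrder.Language in
  by_contra hcons
  have hbot : ¬ Derives (n := 0) Arit ⊥ := fun h => hcons ⟨⊥, h, h.ex_falso _⟩
  obtain ⟨M, _, _, hmodel⟩ := exists_model_of_not_derives_falsum hbot
  have hM : IsRobinson M := isRobinson_of_realize fun S hS => hmodel S (hQ S hS)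
  obtain ⟨f, hf, hfix⟩ := exists_primrec_godelNumber_failsAt c
  obtain ⟨R, ⟨ρ, hρ⟩, hR⟩ := representable_of_primrec hM hf
  -- Since `ρ` represents `f`, this formula says at a standard `x` that `V` holds at `f(x)`; `e` is
  -- its own code.
  obtain ⟨e, he⟩ := hfix (ρ ⊓ truthF (vr 1)).ex
  have hV : qTrue (num M (f e)) ↔
      Sat (default : Fin 0 → M) (failsAt (ρ ⊓ truthF (vr 1)).ex e) := by
    have h := hmodel _ (hT (failsAt (ρ ⊓ truthF (vr 1)).ex e))
    have h' := BoundedFormula.realize_iff.1 h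
    change Sat _ (truthF _) ↔ Sat _ _ at h'
    rwa [sat_truthF, name, val_numeral, he] at h'
  rw [sat_failsAt, sat_ex] at hV
  -- The existential collapses to the single value `f e`, leaving `V(f e) ↔ ¬ V(f e)`.
  simp only [Matrix.Fin.snoc_vecCons, snoc_vecEmpty, sat_inf, hρ, sat_truthF, val_vr, hR] at hV
  simp at hV
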